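/- Let $Z=(Z_t)_{t\ge 0}$ be a standard planar Brownian motion started at the origin, defined on a probability space with probability measure $\mathbf P$. For a domain $V\subseteq\mathbb C$ containing $0$, let $T^V=\inf\{t>0 : Z_t\notin V\}$ (with $\inf\emptyset=\infty$) be its first exit time from $V$, and let $d(V)=\inf\{|z| : z\in\partial V\}$ be the distance from $0$ to the boundary of $V$. Let $U,W\subsetneq\mathbb C$ be simply connected domains, both containing $0$, such that $$d(U)<\frac{1}{\sqrt2}\,d(W).$$ Then, for all sufficiently small $t>0$, $$\mathbf P(T^U<t)>\mathbf P(T^W<t).$$ In fact, $$\lim_{t\to0^+}\frac{\mathbf P(T^U<t)}{\mathbf P(T^W<t)}=\infty.$$ -/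

import Mathlib

open Filter Topology MeasureTheory ProbabilityTheory
open scoped NNReal ENNReal

/-- `Z` is a standard planar Brownian motion started at the origin under `P`: its real and
imaginary parts are independent standard real Brownian motions (with almost surely continuous
paths, and starting at `0` almost surely). -/
structure IsPlanarBrownian {Ω : Type*} {mΩ : MeasurableSpace Ω}
    (Z : ℝ≥0 → Ω → ℂ) (P : Measure Ω) : Prop where
  re : IsBrownianReal (fun t ω => (Z t ω).re) P
  im : IsBrownianReal (fun t ω => (Z t ω).im) P
  indep : IndepFun (fun ω (t : ℝ≥0) => (Z t ω).re) (fun ω (t : ℝ≥0) => (Z t ω).im) P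

/-- The first exit time `inf {s > 0 : Z s ∉ V}` of the process `Z` from the set `V`, with value
`∞` on the paths that never leave `V` at a positive time. -/
noncomputable def exitTime {Ω : Type*} (Z : ℝ≥0 → Ω → ℂ) (V : Set ℂ) (ω : Ω) : ℝ≥0∞ :=
  sInf ((fun s : ℝ≥0 => (s : ℝ≥0∞)) '' {s : ℝ≥0 | 0 < s ∧ Z s ω ∉ V})

/-- `d(V) = inf {|z| : z ∈ ∂V}`. -/
noncomputable def boundaryDist (V : Set ℂ) : ℝ :=
  sInf ((fun z : ℂ => ‖z‖) '' frontier V)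

/-! Both exit probabilities are compared on the exponential scale: `1/4 * exp (-κ / t)` from below
for every κ > d(U)²/2, and `8 * exp (-c² / (2t))` from above for every c < d(W)/√2. When d(U) < c <
d(W)/√2 the two rates are separated and the ratio grows like `exp (const / t)`.

The upper bound (`IsPlanarBrownian.measure_exitTime_le`) is crude: a path that leaves W leaves the
disc of radius d(W), so some coordinate exceeds c in absolute value. Lévy's inequality and a
Chernoff bound finish. Passing from the disc to its inscribed square costs the factor √2 of the
hypothesis.

The lower bound (`IsPlanarBrownian.le_measure_exitTime`) needs topology, since near a boundary point
z₀ with |z₀| = d the complement may be thin. It suffices to run almost straight to z₀ and then make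
a tiny turn around it back into the disc. If such a path stayed in V, a logarithm of 1 - z/z₀ on V,
which exists by simple connectedness, would jump by 2πi (`exists_notMem_of_winding`). The run costs
about `exp (-d² / (2t))`, the turn arbitrarily little in the exponent. That Brownian motion follows
such a polygon is `le_measure_polygonTube`, where the interpolation error is split off as an
independent factor. -/

/-! ### Topology: a path that turns around an omitted point leaves the domain. -/

/-- Two continuous branches of the same logarithm on a preconnected set differ by a constant. -/
theorem sub_eq_sub_of_exp_eqOn {X : Type*} [TopologicalSpace X] {S : Set X}
    (hS : IsPreconnected S) {g h : X → ℂ} (hg : ContinuousOn g S) (hh : ContinuousOn h S)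
    (he : ∀ x ∈ S, Complex.exp (g x) = Complex.exp (h x)) {x y : X} (hx : x ∈ S) (hy : y ∈ S) :
    g x - h x = g y - h y := by
  have key : ∀ z ∈ S, ∃ n : ℤ, g z - h z = n * (2 * Real.pi * Complex.I) := by
    intro z hz
    obtain ⟨n, hn⟩ := Complex.exp_eq_exp_iff_exists_int.1 (he z hz)
    exact ⟨n, by rw [hn]; ring⟩
  have hdisc : IsDiscrete (Set.range ((↑) : ℤ → ℝ)) :=
    ⟨Int.isClosedEmbedding_coe_real.isEmbedding.toHomeomorph.symm.isEmbedding.discreteTopology⟩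
  have him : ∀ z ∈ S, ∀ n : ℤ, g z - h z = n * (2 * Real.pi * Complex.I) →
      (g z - h z).im / (2 * Real.pi) = n := by
    intro z _ n hn
    rw [hn]
    simp
  -- The difference divided by 2πi is continuous with integer values, hence constant on a
  -- preconnected set.
  have hc : ContinuousOn (fun z => (g z - h z).im / (2 * Real.pi)) S :=
    (Complex.continuous_im.comp_continuousOn (hg.sub hh)).div_const _
  have hmaps : Set.MapsTo (fun z => (g z - h z).im / (2 * Real.pi)) S
      (Set.range ((↑) : ℤ → ℝ)) := by
    intro z hz
    obtain ⟨n, hn⟩ := key z hz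
    exact ⟨n, (him z hz n hn).symm⟩
  have hconst := hS.constant_of_mapsTo hdisc hc hmaps hx hy
  obtain ⟨n, hn⟩ := key x hx
  obtain ⟨m, hm⟩ := key y hy
  simp only [him x hx n hn, him y hy m hm] at hconst
  rw [hn, hm, show (n : ℂ) = m by exact_mod_cast hconst]

/-- On the upper half-plane the branches `log w` and `log (-w) + iπ` agree. -/
theorem log_neg_add_of_im_pos {w : ℂ} (hw : 0 < w.im) :
    Complex.log (-w) + Real.pi * Complex.I = Complex.log w := by
  simp only [Complex.log, norm_neg, Complex.arg_neg_eq_arg_sub_pi_of_im_pos hw]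
  push_cast
  ring

/-- On the lower half-plane the branches `log w` and `log (-w) + iπ` differ by `2πi`. -/
theorem log_neg_add_of_im_neg {w : ℂ} (hw : w.im < 0) :
    Complex.log (-w) + Real.pi * Complex.I = Complex.log w + 2 * Real.pi * Complex.I := by
  simp only [Complex.log, norm_neg, Complex.arg_neg_eq_arg_add_pi_of_im_neg hw]
  push_cast
  ring

/-- A path that makes a turn around a point `z₀` outside a simply connected open set `V`, and
whose end points lie in a disc `ball 0 ‖z₀‖ ⊆ V`, leaves `V`. The turn is measured by
`w = 1 - z / z₀`. -/
theorem exists_notMem_of_winding {V : Set ℂ} (hVo : IsOpen V) (hV : IsSimplyConnected V)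
    {z₀ : ℂ} (hz₀ : z₀ ∉ V) (hball : Metric.ball 0 ‖z₀‖ ⊆ V) (hne : z₀ ≠ 0)
    {z : ℝ≥0 → ℂ} (hz : Continuous z) (hz0 : z 0 = 0) {t₁ t₂ : ℝ≥0} (h12 : t₁ ≤ t₂)
    (h1 : ∀ s ≤ t₁, 1 - z s / z₀ ∈ Complex.slitPlane) (h1' : 0 < (1 - z t₁ / z₀).im)
    (h2 : ∀ s, t₁ ≤ s → s ≤ t₂ → -(1 - z s / z₀) ∈ Complex.slitPlane)
    (h2' : (1 - z t₂ / z₀).im < 0) (h3 : ‖z t₂‖ < ‖z₀‖) :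
    ∃ s ≤ t₂, z s ∉ V := by
  by_contra! hcon
  have hg0 : ∀ x ∈ V, 1 - x / z₀ ≠ 0 := by
    intro x hx h
    apply hz₀
    rw [sub_eq_zero, eq_div_iff hne, one_mul] at h
    rwa [h]
  -- Simple connectedness enters here: the zero-free function 1 - z/z₀ has a continuous logarithm on
  -- V.
  obtain ⟨f, hfc, hf⟩ := Complex.exists_continuousOn_eqOn_exp_comp hV hVo
    (g := fun x => 1 - x / z₀) (by fun_prop) (by rintro ⟨x, hx, h⟩; exact hg0 x hx h)
  have hf : ∀ x ∈ V, Complex.exp (f x) = 1 - x / z₀ := fun x hx => hf hx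
  have hslit : ∀ x ∈ Metric.ball (0 : ℂ) ‖z₀‖, 1 - x / z₀ ∈ Complex.slitPlane := by
    intro x hx
    left
    have hx' : ‖x / z₀‖ < 1 := by
      rw [norm_div, div_lt_one (norm_pos_iff.2 hne)]
      simpa using hx
    have := (Complex.re_le_norm (x / z₀)).trans_lt hx'
    simp only [Complex.sub_re, Complex.one_re]
    linarith
  have hexp : ∀ w : ℂ, w ≠ 0 → Complex.exp (Complex.log (-w) + Real.pi * Complex.I) = w := by
    intro w hw
    rw [Complex.exp_add, Complex.exp_log (neg_ne_zero.2 hw), Complex.exp_pi_mul_I]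
    ring
  have hwc : Continuous fun s => 1 - z s / z₀ := by fun_prop
  have hfz : ContinuousOn (fun s => f (z s)) (Set.Icc 0 t₂) :=
    hfc.comp hz.continuousOn fun s hs => hcon s hs.2
  -- comparison on the disc
  have e0 := sub_eq_sub_of_exp_eqOn (convex_ball (0 : ℂ) ‖z₀‖).isPreconnected (g := f)
    (h := fun x => Complex.log (1 - x / z₀)) (hfc.mono hball)
    (ContinuousOn.clog (by fun_prop) hslit)
    (fun x hx => by rw [hf x (hball hx), Complex.exp_log (hg0 x (hball hx))])
    (x := z 0) (y := z t₂) (by simpa [hz0] using hne) (by simpa using h3)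
  have e1 := sub_eq_sub_of_exp_eqOn (isPreconnected_Icc (a := (0 : ℝ≥0)) (b := t₁))
    (g := fun s => f (z s)) (h := fun s => Complex.log (1 - z s / z₀))
    (hfz.mono (Set.Icc_subset_Icc_right h12))
    (ContinuousOn.clog hwc.continuousOn fun s hs => h1 s hs.2)
    (fun s hs => by
      rw [hf _ (hcon s (hs.2.trans h12)), Complex.exp_log (hg0 _ (hcon s (hs.2.trans h12)))])
    (x := 0) (y := t₁) (by simp) (by simp)
  have e2 := sub_eq_sub_of_exp_eqOn (isPreconnected_Icc (a := t₁) (b := t₂))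
    (g := fun s => f (z s))
    (h := fun s => Complex.log (-(1 - z s / z₀)) + Real.pi * Complex.I)
    (hfz.mono (Set.Icc_subset_Icc_left (zero_le)))
    ((ContinuousOn.clog hwc.neg.continuousOn fun s hs => h2 s hs.1 hs.2).add continuousOn_const)
    (fun s hs => by rw [hf _ (hcon s hs.2), hexp _ (hg0 _ (hcon s hs.2))])
    (x := t₁) (y := t₂) (by simp [h12]) (by simp [h12])
  -- The two branches agree at t₁ but differ by 2πi at t₂, so along the path `f` minus the principal
  -- logarithm changes by 2πi. By `e0` it is constant on the disc, which contains both end points.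
  simp only [log_neg_add_of_im_pos h1', log_neg_add_of_im_neg h2'] at e2
  have : (2 * Real.pi * Complex.I : ℂ) = 0 := by linear_combination e1 + e2 - e0
  exact Complex.two_pi_I_ne_zero this

/-- A path that stays close to the polygonal line `0, (1+r)-ri, (1-r)+5ri`, measured relative to
`z₀`, winds around `z₀`. -/
theorem exists_notMem_of_near_polygon {V : Set ℂ} (hVo : IsOpen V) (hV : IsSimplyConnected V)
    {z₀ : ℂ} (hz₀ : z₀ ∉ V) (hball : Metric.ball 0 ‖z₀‖ ⊆ V) (hne : z₀ ≠ 0)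
    {z : ℝ≥0 → ℂ} (hz : Continuous z) (hz0 : z 0 = 0) {t₁ t₂ : ℝ≥0} (h0 : 0 < t₁) (h12 : t₁ < t₂)
    {r : ℝ} (hr : 0 < r) (hr' : r ≤ 1 / 26)
    (h1 : ∀ s ≤ t₁, ‖z s - (s / t₁ : ℝ) * (z₀ * ⟨1 + r, -r⟩)‖ ≤ ‖z₀‖ * (r / 4))
    (h2 : ∀ s, t₁ ≤ s → s ≤ t₂ → ‖z s - (z₀ * ⟨1 + r, -r⟩ +
      ((s - t₁) / (t₂ - t₁) : ℝ) * (z₀ * ⟨-2 * r, 6 * r⟩))‖ ≤ ‖z₀‖ * (r / 4)) :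
    ∃ s ≤ t₂, z s ∉ V := by
  have hn : 0 < ‖z₀‖ := norm_pos_iff.2 hne
  have t1 : (0 : ℝ) < t₁ := h0
  have t12 : (0 : ℝ) < t₂ - t₁ := sub_pos.2 (by exact_mod_cast h12)
  have key : ∀ (x m : ℂ), ‖x - z₀ * m‖ ≤ ‖z₀‖ * (r / 4) →
      |(1 - x / z₀).re - (1 - m.re)| ≤ r / 4 ∧ |(1 - x / z₀).im + m.im| ≤ r / 4 := by
    intro x m h
    have e : x - z₀ * m = z₀ * (x / z₀ - m) := by field_simp
    rw [e, norm_mul, mul_le_mul_iff_right₀ hn] at h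
    constructor
    · refine le_trans ?_ ((Complex.abs_re_le_norm _).trans h)
      rw [← abs_neg]
      simp
    · refine le_trans ?_ ((Complex.abs_im_le_norm _).trans h)
      rw [← abs_neg]
      simp
      apply le_of_eq
      congr 1
      ring
  have k1 : ∀ s ≤ t₁, |(1 - z s / z₀).re - (1 - s / t₁ * (1 + r))| ≤ r / 4 ∧
      |(1 - z s / z₀).im - s / t₁ * r| ≤ r / 4 := by
    intro s hs
    have := key (z s) ((s / t₁ : ℝ) * ⟨1 + r, -r⟩) (by convert h1 s hs using 3; ring)
    rw [Complex.re_ofReal_mul, Complex.im_ofReal_mul] at this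
    simpa [sub_eq_add_neg] using this
  have k2 : ∀ s, t₁ ≤ s → s ≤ t₂ →
      |(1 - z s / z₀).re - (-r + (s - t₁) / (t₂ - t₁) * (2 * r))| ≤ r / 4 ∧
      |(1 - z s / z₀).im - (r - (s - t₁) / (t₂ - t₁) * (6 * r))| ≤ r / 4 := by
    intro s hs hs'
    have := key (z s) (⟨1 + r, -r⟩ + ((s - t₁) / (t₂ - t₁) : ℝ) * ⟨-2 * r, 6 * r⟩)
      (by convert h2 s hs hs' using 3; ring)
    rw [Complex.add_re, Complex.add_im, Complex.re_ofReal_mul, Complex.im_ofReal_mul] at this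
    constructor
    · convert this.1 using 2; ring
    · convert this.2 using 2; ring
  refine exists_notMem_of_winding hVo hV hz₀ hball hne hz hz0 h12.le ?_ ?_ ?_ ?_ ?_
  · intro s hs
    obtain ⟨a, b⟩ := k1 s hs
    rw [abs_le] at a b
    have l0 : 0 ≤ (s / t₁ : ℝ) := by positivity
    -- On this leg w = 1 - z/z₀ runs from 1 to -r + ri: its real part is positive in the first half,
    -- its imaginary part in the second.
    rcases le_total (s / t₁ : ℝ) (1 / 2) with h | h
    · left; nlinarith
    · right; apply ne_of_gt; nlinarith
  · obtain ⟨-, b⟩ := k1 t₁ le_rfl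
    rw [div_self t1.ne', abs_le] at b
    linarith
  · intro s hs hs'
    obtain ⟨a, b⟩ := k2 s hs hs'
    rw [abs_le] at a b
    -- Here w runs from -r + ri to r - 5ri, crossing the negative real axis. With the tolerance r/4,
    -- Re w ≤ -r/12 up to parameter 1/3 and Im w ≤ -3r/4 after it.
    rcases le_total ((s - t₁) / (t₂ - t₁) : ℝ) (1 / 3) with h | h
    · left; rw [Complex.neg_re]; nlinarith
    · right; rw [Complex.neg_im]; apply ne_of_gt; nlinarith
  · obtain ⟨-, b⟩ := k2 t₂ h12.le le_rfl
    rw [div_self t12.ne', abs_le] at b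
    linarith
  -- The end node has |z/z₀|² = 1 - 2r + 26r², at most 1 - r when r ≤ 1/26, which leaves room for
  -- the tolerance.
  · obtain ⟨a, b⟩ := k2 t₂ h12.le le_rfl
    rw [div_self t12.ne', abs_le] at a b
    have e : ‖z t₂‖ = ‖z₀‖ * ‖z t₂ / z₀‖ := by rw [norm_div]; field_simp
    rw [e]
    refine mul_lt_of_lt_one_right hn ?_
    rw [Complex.sub_re, Complex.one_re] at a
    rw [Complex.sub_im, Complex.one_im] at b
    rw [← sq_lt_one_iff₀ (norm_nonneg _), Complex.sq_norm, Complex.normSq_apply]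
    nlinarith

/-! ### Gaussian upper bounds and the maximal inequality. -/

theorem half_le_gaussianReal_Ici_zero (v : ℝ≥0) : 1 / 2 ≤ gaussianReal 0 v (Set.Ici 0) := by
  have h1 : gaussianReal 0 v (Set.Iic 0) = gaussianReal 0 v (Set.Ici 0) := by
    have h := gaussianReal_map_neg (μ := 0) (v := v)
    rw [neg_zero] at h
    conv_rhs => rw [← h]
    rw [Measure.map_apply measurable_neg measurableSet_Ici]
    congr 1
    ext x
    simp
  have h2 : (1 : ℝ≥0∞) ≤ gaussianReal 0 v (Set.Ici 0) + gaussianReal 0 v (Set.Ici 0) := by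
    calc (1 : ℝ≥0∞) = gaussianReal 0 v (Set.Iic 0 ∪ Set.Ici 0) := by
          rw [Set.Iic_union_Ici, measure_univ]
      _ ≤ _ := by
          refine (measure_union_le _ _).trans ?_
          rw [h1]
  rw [← two_mul] at h2
  exact ENNReal.div_le_of_le_mul' h2

/-- Lévy's maximal inequality for a pre-Brownian motion along finitely many times. -/
theorem ProbabilityTheory.IsPreBrownianReal.measure_exists_le_le {Ω : Type*}
    [MeasurableSpace Ω] {P : Measure Ω} {B : ℝ≥0 → Ω → ℝ} (hB : IsPreBrownianReal B P)
    {u : ℕ → ℝ≥0} (hu : Monotone u) (n : ℕ) (c : ℝ) :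
    P {ω | ∃ k ≤ n, c ≤ B (u k) ω} ≤ 2 * P {ω | c ≤ B (u n) ω} := by
  -- `A k` is first passage at index k, and `D k` says that the later increment up to `u n` is
  -- nonnegative. `D k` is independent of `A k` and has probability at least 1/2; the disjoint
  -- events `A k ∩ D k` all force `c ≤ B (u n)`.
  set A : ℕ → Set Ω := fun k => {ω | c ≤ B (u k) ω ∧ ∀ j : Fin k, B (u j) ω < c} with hA
  -- The time `u k + (u n - u k)` is just `u n` for k ≤ n, written in the form of the shifted
  -- process.
  set D : ℕ → Set Ω := fun k => {ω | 0 ≤ B (u k + (u n - u k)) ω - B (u k) ω} with hD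
  have hAD : ∀ k ≤ n, P (A k) ≤ 2 * P (A k ∩ D k) := by
    intro k hk
    have hi := (hB.indepFun_shift (u k)).measure_inter_preimage_eq_mul
      {x : ℝ≥0 → ℝ | 0 ≤ x (u n - u k)}
      {x : Set.Iic (u k) → ℝ | c ≤ x ⟨u k, Set.mem_Iic.2 le_rfl⟩ ∧ ∀ j : Fin k, x ⟨u j, Set.mem_Iic.2 (hu j.2.le)⟩ < c}
      (measurableSet_le measurable_const (measurable_pi_apply _))
      (by
        rw [Set.ofPred_and, Set.ofPred_forall]
        exact (measurableSet_le measurable_const (measurable_pi_apply _)).inter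
          (MeasurableSet.iInter fun j =>
            measurableSet_lt (measurable_pi_apply _) measurable_const))
    have hi : P (D k ∩ A k) = P (D k) * P (A k) := hi
    have hD2 : 1 / 2 ≤ P (D k) := by
      rw [((hB.shift (u k)).hasLaw_eval (u n - u k)).measure_eq (p := fun x => 0 ≤ x)
        measurableSet_Ici]
      exact half_le_gaussianReal_Ici_zero _
    rw [Set.inter_comm, hi, ← mul_assoc]
    refine le_mul_of_one_le_left (zero_le) ?_
    calc (1 : ℝ≥0∞) = 2 * (1 / 2) := by
          rw [one_div, ENNReal.mul_inv_cancel (by simp) (by simp)]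
      _ ≤ _ := by gcongr
  have hmeas : ∀ t, NullMeasurableSet {ω | c ≤ B t ω} P := fun t =>
    (hB.aemeasurable t).nullMeasurableSet_preimage measurableSet_Ici
  have hmeas' : ∀ t, NullMeasurableSet {ω | B t ω < c} P := fun t =>
    (hB.aemeasurable t).nullMeasurableSet_preimage measurableSet_Iio
  have hAm : ∀ k, NullMeasurableSet (A k) P := by
    intro k
    simp only [hA]
    rw [Set.ofPred_and, Set.ofPred_forall]
    exact (hmeas _).inter (NullMeasurableSet.iInter fun j => hmeas' _)
  have hDm : ∀ k, NullMeasurableSet (D k) P := fun k =>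
    ((hB.aemeasurable _).sub (hB.aemeasurable _)).nullMeasurableSet_preimage measurableSet_Ici
  have hdisj : Pairwise (Function.onFun Disjoint fun k => A k ∩ D k) := by
    rw [pairwise_disjoint_on]
    intro i j hij
    rw [Set.disjoint_left]
    rintro ω ⟨⟨h1, -⟩, -⟩ ⟨⟨-, h2⟩, -⟩
    exact absurd (h2 ⟨i, hij⟩) (not_lt.2 h1)
  calc P {ω | ∃ k ≤ n, c ≤ B (u k) ω} ≤ P (⋃ k ∈ Finset.range (n + 1), A k) := by
        refine measure_mono ?_
        rintro ω ⟨k, hk, h⟩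
        classical
        have hex : ∃ k, c ≤ B (u k) ω := ⟨k, h⟩
        simp only [Set.mem_iUnion]
        refine ⟨Nat.find hex, Finset.mem_range.2 ?_, Nat.find_spec hex, fun j => ?_⟩
        · exact Nat.lt_succ_of_le ((Nat.find_min' hex h).trans hk)
        · exact not_le.1 (Nat.find_min hex j.2)
    _ ≤ ∑ k ∈ Finset.range (n + 1), P (A k) := measure_biUnion_finset_le _ _
    _ ≤ ∑ k ∈ Finset.range (n + 1), 2 * P (A k ∩ D k) :=
        Finset.sum_le_sum fun k hk => hAD k (Nat.lt_succ_iff.1 (Finset.mem_range.1 hk))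
    _ = 2 * P (⋃ k ∈ Finset.range (n + 1), A k ∩ D k) := by
        rw [← Finset.mul_sum, measure_biUnion_finset₀]
        · exact fun i _ j _ hij => (hdisj hij).aedisjoint
        · exact fun k _ => (hAm k).inter (hDm k)
    _ ≤ 2 * P {ω | c ≤ B (u n) ω} := by
        gcongr
        simp only [Set.iUnion_subset_iff]
        rintro k hk ω ⟨⟨h1, -⟩, h2⟩
        have hk' : k ≤ n := Nat.lt_succ_iff.1 (Finset.mem_range.1 hk)
        simp only [hD, Set.mem_ofPred_eq, add_tsub_cancel_of_le (hu hk')] at h2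
        simp only [Set.mem_ofPred_eq]
        linarith

theorem ProbabilityTheory.IsPreBrownianReal.measure_le_le {Ω : Type*}
    [MeasurableSpace Ω] {P : Measure Ω} {B : ℝ≥0 → Ω → ℝ} (hB : IsPreBrownianReal B P)
    {t : ℝ≥0} (ht : 0 < t) {c : ℝ} (hc : 0 ≤ c) :
    P {ω | c ≤ B t ω} ≤ ENNReal.ofReal (Real.exp (-c ^ 2 / (2 * t))) := by
  have ht' : (0 : ℝ) < t := ht
  rw [(hB.hasLaw_eval t).measure_eq (p := fun x => c ≤ x) measurableSet_Ici,
    ← ofReal_measureReal]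
  refine ENNReal.ofReal_le_ofReal ?_
  -- The parameter c/t is the optimal one in the Chernoff bound.
  have h := measure_ge_le_exp_mul_mgf (μ := gaussianReal 0 t) (X := id) (t := c / t) c
    (by positivity) (integrable_exp_mul_gaussianReal _)
  rw [mgf_id_gaussianReal, ← Real.exp_add] at h
  refine h.trans (Real.exp_le_exp.2 (le_of_eq ?_))
  field_simp
  ring

/-- Lévy's inequality on the grids of mesh t/n, transferred by path continuity: the strict
inequality is an open condition, so it persists at nearby grid points for all large n. -/
theorem ProbabilityTheory.IsBrownianReal.measure_exists_lt_le {Ω : Type*}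
    [MeasurableSpace Ω] {P : Measure Ω} {B : ℝ≥0 → Ω → ℝ} (hB : IsBrownianReal B P)
    {t : ℝ≥0} (ht : 0 < t) {c : ℝ} (hc : 0 ≤ c) :
    P {ω | ∃ s < t, c < B s ω} ≤ 2 * ENNReal.ofReal (Real.exp (-c ^ 2 / (2 * t))) := by
  have ht' : (0 : ℝ) < t := ht
  set E : ℕ → Set Ω := fun n => {ω | ∃ k ≤ n, c ≤ B ((k / n : ℝ≥0) * t) ω} with hE
  have hEn : ∀ n, 1 ≤ n → P (E n) ≤ 2 * ENNReal.ofReal (Real.exp (-c ^ 2 / (2 * t))) := by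
    intro n hn
    have hn' : (n : ℝ≥0) ≠ 0 := by positivity
    refine (hB.measure_exists_le_le (u := fun k => (k / n : ℝ≥0) * t) ?_ n c).trans ?_
    · intro i j hij
      dsimp only
      gcongr
    · rw [div_self hn', one_mul]
      gcongr
      exact hB.measure_le_le ht hc
  -- The `E n` are not nested, hence this lower limit of sets, which is increasing. Starting at `m +
  -- 1` avoids the degenerate grid n = 0.
  set F : ℕ → Set Ω := fun m => ⋂ n ≥ m + 1, E n with hF
  have hFm : Monotone F := by
    intro i j hij ω hω
    simp only [hF, Set.mem_iInter] at hω ⊢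
    exact fun n hn => hω n (by omega)
  calc P {ω | ∃ s < t, c < B s ω} ≤ P (⋃ m, F m) := by
        refine measure_mono_ae ?_
        filter_upwards [hB.cont] with ω hω
        rintro ⟨s, hs, hsc⟩
        have hlim : Tendsto (fun n : ℕ => (⌊(s / t : ℝ) * n⌋₊ / n : ℝ≥0) * t) atTop (𝓝 s) := by
          rw [← NNReal.tendsto_coe]
          have h := ((tendsto_nat_floor_mul_div_atTop (R := ℝ) (a := (s / t : ℝ))
            (by positivity)).comp tendsto_natCast_atTop_atTop).mul_const (t : ℝ)
          rw [div_mul_cancel₀ _ ht'.ne'] at h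
          simpa [Function.comp_def] using h
        have hev := (hω.tendsto s).comp hlim |>.eventually (lt_mem_nhds hsc)
        obtain ⟨m, hm⟩ := eventually_atTop.1 hev
        refine Set.mem_iUnion.2 ⟨m, Set.mem_iInter₂.2 fun n hn => ?_⟩
        refine ⟨⌊(s / t : ℝ) * n⌋₊, ?_, (hm n (by omega)).le⟩
        refine Nat.floor_le_of_le ?_
        refine mul_le_of_le_one_left (Nat.cast_nonneg _) ?_
        rw [div_le_one ht']
        exact_mod_cast hs.le
    _ = ⨆ m, P (F m) := hFm.measure_iUnion
    _ ≤ _ := iSup_le fun m =>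
        (measure_mono (Set.iInter₂_subset (m + 1) le_rfl)).trans
          (hEn (m + 1) (by omega))

/-! ### Distance to the boundary and the upper bound for exit probabilities. -/

/-- A connected set that meets the open set V and misses its frontier lies in V. -/
theorem ball_subset_of_isOpen {V : Set ℂ} (hV : IsOpen V) (h0 : (0 : ℂ) ∈ V) :
    Metric.ball 0 (boundaryDist V) ⊆ V := by
  rcases le_or_gt (boundaryDist V) 0 with h | hpos
  · simp [Metric.ball_eq_empty.2 h]
  refine (convex_ball (0 : ℂ) _).isPreconnected.subset_of_closure_inter_subset hV
    ⟨0, by simpa using hpos, h0⟩ ?_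
  rintro y ⟨hy, hyb⟩
  by_contra hyV
  have : boundaryDist V ≤ ‖y‖ :=
    csInf_le ⟨0, by rintro _ ⟨z, -, rfl⟩; exact norm_nonneg z⟩
      ⟨y, by rw [hV.frontier_eq]; exact ⟨hy, hyV⟩, rfl⟩
  simp only [Metric.mem_ball, dist_zero_right] at hyb
  linarith

theorem exists_frontier_norm_eq {V : Set ℂ} (hV : IsOpen V) (h0 : (0 : ℂ) ∈ V)
    (hne : V ≠ Set.univ) : ∃ z ∉ V, z ≠ 0 ∧ ‖z‖ = boundaryDist V := by
  have hfne : (frontier V).Nonempty := nonempty_frontier_iff.2 ⟨⟨0, h0⟩, hne⟩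
  obtain ⟨z, hz, hzd⟩ := isClosed_frontier.exists_infDist_eq_dist hfne (0 : ℂ)
  have hzV : z ∉ V := by
    rw [hV.frontier_eq] at hz
    exact hz.2
  refine ⟨z, hzV, by rintro rfl; exact hzV h0, ?_⟩
  refine le_antisymm ?_ (csInf_le ⟨0, by rintro _ ⟨z, -, rfl⟩; exact norm_nonneg z⟩ ⟨z, hz, rfl⟩)
  refine le_csInf (hfne.image _) ?_
  rintro _ ⟨y, hy, rfl⟩
  have := Metric.infDist_le_dist_of_mem hy (x := (0 : ℂ))
  rw [hzd] at this
  simpa using this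

/-- The probability of leaving a domain before time `t` is at most of order `exp (-c² / 2t)` for
any `c < d(W) / √2`. -/
theorem IsPlanarBrownian.measure_exitTime_le {Ω : Type*} [MeasurableSpace Ω] {P : Measure Ω}
    {Z : ℝ≥0 → Ω → ℂ} (hZ : IsPlanarBrownian Z P) {W : Set ℂ} (hWo : IsOpen W)
    (hW0 : (0 : ℂ) ∈ W) {c : ℝ} (hc : 0 ≤ c) (hcW : 2 * c ^ 2 < boundaryDist W ^ 2)
    {t : ℝ} (ht : 0 < t) :
    P {ω | exitTime Z W ω < ENNReal.ofReal t} ≤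
      8 * ENNReal.ofReal (Real.exp (-c ^ 2 / (2 * t))) := by
  lift t to ℝ≥0 using ht.le
  have ht : 0 < t := ht
  have hb : 0 ≤ boundaryDist W := Real.sInf_nonneg (by rintro _ ⟨z, -, rfl⟩; exact norm_nonneg z)
  -- If both coordinates stayed in [-c, c], then |Z|² ≤ 2c² < d(W)². The constant 8 is four
  -- half-planes times Lévy's factor 2.
  have hsub : {ω | exitTime Z W ω < ENNReal.ofReal t} ⊆
      ({ω | ∃ s < t, c < (Z s ω).re} ∪ {ω | ∃ s < t, c < -(Z s ω).re}) ∪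
      ({ω | ∃ s < t, c < (Z s ω).im} ∪ {ω | ∃ s < t, c < -(Z s ω).im}) := by
    intro ω hω
    simp only [Set.mem_ofPred_eq, exitTime, sInf_lt_iff, Set.mem_image] at hω
    obtain ⟨_, ⟨s, ⟨-, hsW⟩, rfl⟩, hst⟩ := hω
    have hst : s < t := by simpa using hst
    have hn : boundaryDist W ≤ ‖Z s ω‖ := by
      by_contra! h
      exact hsW (ball_subset_of_isOpen hWo hW0 (by simpa using h))
    by_contra hcon
    simp only [Set.mem_union, Set.mem_ofPred_eq, not_or, not_exists, not_and, not_lt] at hcon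
    have h1 := hcon.1.1 s hst
    have h2 := hcon.1.2 s hst
    have h3 := hcon.2.1 s hst
    have h4 := hcon.2.2 s hst
    have h5 : ‖Z s ω‖ ^ 2 = (Z s ω).re * (Z s ω).re + (Z s ω).im * (Z s ω).im := by
      rw [Complex.sq_norm, Complex.normSq_apply]
    have h6 := pow_le_pow_left₀ hb hn 2
    nlinarith
  refine (measure_mono hsub).trans ((measure_union_le _ _).trans ?_)
  have h1 := hZ.re.measure_exists_lt_le ht hc
  have h2 := hZ.re.neg.measure_exists_lt_le ht hc
  have h3 := hZ.im.measure_exists_lt_le ht hc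
  have h4 := hZ.im.neg.measure_exists_lt_le ht hc
  simp only [Pi.neg_apply] at h2 h4
  refine (add_le_add ((measure_union_le _ _).trans (add_le_add h1 h2))
    ((measure_union_le _ _).trans (add_le_add h3 h4))).trans (le_of_eq ?_)
  ring

/-! ### Lower bounds for following a polygonal line. -/

/-- The hypothesis on v makes the length 2δ of the interval absorb the normalising factor √(2πv) of
the density. -/
theorem exp_le_gaussianReal_Icc {v : ℝ≥0} (hv : 0 < v) {δ : ℝ} (hδ : 0 < δ)
    (hvδ : 2 * Real.pi * v ≤ 4 * δ ^ 2) (m : ℝ) :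
    ENNReal.ofReal (Real.exp (-(|m| + δ) ^ 2 / (2 * v))) ≤
      gaussianReal 0 v (Set.Icc (m - δ) (m + δ)) := by
  have hv' : (0 : ℝ) < v := hv
  have hs : 0 < √(2 * Real.pi * v) := by positivity
  rw [gaussianReal_apply _ hv.ne']
  calc ENNReal.ofReal (Real.exp (-(|m| + δ) ^ 2 / (2 * v)))
      ≤ ENNReal.ofReal ((√(2 * Real.pi * v))⁻¹ * Real.exp (-(|m| + δ) ^ 2 / (2 * v))) *
          ENNReal.ofReal (2 * δ) := by
        rw [← ENNReal.ofReal_mul (by positivity)]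
        refine ENNReal.ofReal_le_ofReal ?_
        have h1 : √(2 * Real.pi * v) ≤ 2 * δ := by
          rw [Real.sqrt_le_left (by positivity)]
          linarith
        have h2 : 1 ≤ (√(2 * Real.pi * v))⁻¹ * (2 * δ) := by
          rw [inv_mul_eq_div, one_le_div hs]
          exact h1
        nlinarith [Real.exp_pos (-(|m| + δ) ^ 2 / (2 * v))]
    _ = ∫⁻ _ in Set.Icc (m - δ) (m + δ),
          ENNReal.ofReal ((√(2 * Real.pi * v))⁻¹ * Real.exp (-(|m| + δ) ^ 2 / (2 * v))) := by
        rw [setLIntegral_const, Real.volume_Icc]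
        congr 2
        ring
    _ ≤ _ := by
        refine setLIntegral_mono (measurable_gaussianPDF _ _) fun x hx => ?_
        rw [gaussianPDF, gaussianPDFReal]
        have : |x| ≤ |m| + δ := by
          have h1 : |x - m| ≤ δ := by
            rw [abs_le]
            constructor <;> linarith [hx.1, hx.2]
          calc |x| = |m + (x - m)| := by ring_nf
            _ ≤ |m| + |x - m| := abs_add_le _ _
            _ ≤ _ := by linarith
        have hsq : (x - 0) ^ 2 ≤ (|m| + δ) ^ 2 := by
          rw [sub_zero, ← sq_abs x]
          gcongr
        refine ENNReal.ofReal_le_ofReal (mul_le_mul_of_nonneg_left (Real.exp_le_exp.2 ?_)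
          (by positivity))
        exact div_le_div_of_nonneg_right (neg_le_neg hsq) (by positivity)

/-- The deviation of a path, stopped at `t₂`, from its linear interpolation at `0, t₁, t₂`. -/
noncomputable def interpolationError (t₁ t₂ : ℝ≥0) (x : ℝ≥0 → ℝ) (s : ℝ≥0) : ℝ :=
  x (min s t₂) - (min s t₁ / t₁ : ℝ≥0) * x t₁ -
    ((min s t₂ - min s t₁) / (t₂ - t₁) : ℝ≥0) * (x t₂ - x t₁)

theorem continuous_interpolationError (t₁ t₂ : ℝ≥0) {x : ℝ≥0 → ℝ} (hx : Continuous x) :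
    Continuous (interpolationError t₁ t₂ x) := by
  unfold interpolationError
  simp only [div_eq_mul_inv]
  fun_prop

/-- Four values of the path occur, each with weight at most 1. -/
theorem abs_interpolationError_le {t₁ t₂ : ℝ≥0} (h12 : t₁ ≤ t₂) {x : ℝ≥0 → ℝ} {ε : ℝ}
    (hx : ∀ s ≤ t₂, |x s| ≤ ε) (s : ℝ≥0) : |interpolationError t₁ t₂ x s| ≤ 4 * ε := by
  have h1 := hx (min s t₂) (min_le_right _ _)
  have h2 := hx t₁ h12
  have h3 := hx t₂ le_rfl
  have hε : 0 ≤ ε := (abs_nonneg _).trans h2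
  have c1 : (min s t₁ / t₁ : ℝ≥0) ≤ 1 := div_le_one_of_le₀ (min_le_right _ _) zero_le
  have c2 : ((min s t₂ - min s t₁) / (t₂ - t₁) : ℝ≥0) ≤ 1 := by
    refine div_le_one_of_le₀ ?_ zero_le
    rcases le_total s t₁ with h | h
    · simp [h, h.trans h12]
    · rw [min_eq_right h]
      exact tsub_le_tsub_right (min_le_right _ _) _
  unfold interpolationError
  generalize (min s t₁ / t₁ : ℝ≥0) = a at *
  generalize ((min s t₂ - min s t₁) / (t₂ - t₁) : ℝ≥0) = b at *
  have ha : |(a : ℝ) * x t₁| ≤ 1 * ε := by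
    rw [abs_mul, NNReal.abs_eq]
    exact mul_le_mul (by exact_mod_cast c1) h2 (abs_nonneg _) zero_le_one
  have hb : |(b : ℝ) * (x t₂ - x t₁)| ≤ 1 * (2 * ε) := by
    rw [abs_mul, NNReal.abs_eq]
    refine mul_le_mul (by exact_mod_cast c2) ?_ (abs_nonneg _) zero_le_one
    linarith [abs_sub (x t₂) (x t₁)]
  have e1 := abs_sub (x (min s t₂) - a * x t₁) (b * (x t₂ - x t₁))
  have e2 := abs_sub (x (min s t₂)) (a * x t₁)
  linarith

/-- The interpolation error of a pre-Brownian motion is independent of the values at the nodes. -/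
theorem ProbabilityTheory.IsPreBrownianReal.indepFun_interpolationError {Ω : Type*}
    [MeasurableSpace Ω] {P : Measure Ω} {B : ℝ≥0 → Ω → ℝ} (hB : IsPreBrownianReal B P)
    {t₁ t₂ : ℝ≥0} (h1 : 0 < t₁) (h12 : t₁ < t₂) :
    IndepFun (fun ω s => interpolationError t₁ t₂ (fun t => B t ω) s)
      (fun ω (i : Fin 2) => B (![t₁, t₂] i) ω) P := by
  have := hB.isGaussianProcess.isProbabilityMeasure
  have mX t := hB.aemeasurable t
  have hL t : MemLp (B t) 2 P := (hB.isGaussianProcess.hasGaussianLaw_eval t).memLp_two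
  apply IsGaussianProcess.indepFun_of_covariance_eq_zero
    (X := fun s ω => interpolationError t₁ t₂ (fun t => B t ω) s)
    (Y := fun i ω => B (![t₁, t₂] i) ω)
  · apply hB.isGaussianProcess.of_isGaussianProcess
    rintro (s | i)
    · exact ⟨{min s t₂, t₁, t₂},
        { toFun x := x ⟨min s t₂, by simp⟩ - (min s t₁ / t₁ : ℝ≥0) * x ⟨t₁, by simp⟩ -
            ((min s t₂ - min s t₁) / (t₂ - t₁) : ℝ≥0) * (x ⟨t₂, by simp⟩ - x ⟨t₁, by simp⟩)
          map_add' x y := by simp only [Pi.add_apply]; ring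
          map_smul' c x := by simp only [Pi.smul_apply, smul_eq_mul, RingHom.id_apply]; ring },
        by intro ω; rfl⟩
    · exact ⟨{![t₁, t₂] i},
        { toFun x := x ⟨![t₁, t₂] i, by simp⟩
          map_add' x y := by simp
          map_smul' c x := by simp }, by simp⟩
  · intro s
    unfold interpolationError
    fun_prop
  · intro i
    fun_prop
  · intro s i
    -- By joint Gaussianity zero covariance suffices. It vanishes because, for t a node, s ↦ min
    -- (min s t₂) t is linear between nodes and so equals its own interpolation.
    have hcov : ∀ t, cov[fun ω => interpolationError t₁ t₂ (fun t => B t ω) s, B t; P] =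
        min (min s t₂) t - (min s t₁ / t₁ : ℝ≥0) * min t₁ t -
          ((min s t₂ - min s t₁) / (t₂ - t₁) : ℝ≥0) * (min t₂ t - min t₁ t) := by
      intro t
      generalize ha : ((min s t₁ / t₁ : ℝ≥0) : ℝ) = a
      generalize hb : (((min s t₂ - min s t₁) / (t₂ - t₁) : ℝ≥0) : ℝ) = b
      have e : (fun ω => interpolationError t₁ t₂ (fun t => B t ω) s) =
          (B (min s t₂) - fun ω => a * B t₁ ω) - fun ω => b * (B t₂ - B t₁) ω := by
        funext ω
        simp only [interpolationError, ha, hb, Pi.sub_apply]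
      rw [e, covariance_sub_left ((hL _).sub ((hL _).const_mul _))
        (((hL _).sub (hL _)).const_mul _) (hL _), covariance_sub_left (hL _)
        ((hL _).const_mul _) (hL _), covariance_const_mul_left, covariance_const_mul_left,
        covariance_sub_left (hL _) (hL _) (hL _), hB.covariance_eval, hB.covariance_eval,
        hB.covariance_eval]
    have t1 : (t₁ : ℝ) ≠ 0 := by exact_mod_cast h1.ne'
    have t12 : (t₂ - t₁ : ℝ) ≠ 0 := (sub_pos.2 (by exact_mod_cast h12)).ne'
    have hle : min s t₁ ≤ min s t₂ := min_le_min_left _ h12.le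
    fin_cases i
    · refine (hcov t₁).trans ?_
      rw [min_self, min_eq_right h12.le, min_assoc, min_eq_right h12.le]
      push_cast
      field_simp
      ring
    · refine (hcov t₂).trans ?_
      rw [min_self, min_eq_left h12.le, min_assoc, min_self]
      push_cast [NNReal.coe_sub hle, NNReal.coe_sub h12.le]
      field_simp
      ring

/-- Paths close to the polygonal line through `0`, `m₁`, `m₁ + m₂` at times `0`, `t₁`, `t₂`. -/
def polygonTube (t₁ t₂ : ℝ≥0) (m₁ m₂ δ : ℝ) : Set (ℝ≥0 → ℝ) :=
  {x | (∀ n, |interpolationError t₁ t₂ x (TopologicalSpace.denseSeq ℝ≥0 n)| ≤ δ) ∧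
    x t₁ ∈ Set.Icc (m₁ - δ) (m₁ + δ) ∧ x t₂ - x t₁ ∈ Set.Icc (m₂ - δ) (m₂ + δ)}

theorem measurableSet_polygonTube (t₁ t₂ : ℝ≥0) (m₁ m₂ δ : ℝ) :
    MeasurableSet (polygonTube t₁ t₂ m₁ m₂ δ) := by
  have hm : ∀ s, Measurable fun x : ℝ≥0 → ℝ => interpolationError t₁ t₂ x s := by
    intro s
    unfold interpolationError
    fun_prop
  have h1 : MeasurableSet {x : ℝ≥0 → ℝ |
      ∀ n, |interpolationError t₁ t₂ x (TopologicalSpace.denseSeq ℝ≥0 n)| ≤ δ} := by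
    rw [Set.ofPred_forall]
    exact MeasurableSet.iInter fun n =>
      measurableSet_le (continuous_abs.measurable.comp (hm _)) measurable_const
  have h2 : MeasurableSet {x : ℝ≥0 → ℝ | x t₁ ∈ Set.Icc (m₁ - δ) (m₁ + δ)} :=
    (measurable_pi_apply t₁) measurableSet_Icc
  have h3 : MeasurableSet {x : ℝ≥0 → ℝ | x t₂ - x t₁ ∈ Set.Icc (m₂ - δ) (m₂ + δ)} :=
    ((measurable_pi_apply t₂).sub (measurable_pi_apply t₁)) measurableSet_Icc
  exact h1.inter (h2.inter h3)

/-- The tube tests only countably many times, for measurability; continuity recovers the others. -/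
theorem abs_interpolationError_le_of_mem {t₁ t₂ : ℝ≥0} {m₁ m₂ δ : ℝ} {x : ℝ≥0 → ℝ}
    (hx : Continuous x) (h : x ∈ polygonTube t₁ t₂ m₁ m₂ δ) (s : ℝ≥0) :
    |interpolationError t₁ t₂ x s| ≤ δ := by
  have hc := continuous_interpolationError t₁ t₂ hx
  refine isClosed_property (TopologicalSpace.denseRange_denseSeq ℝ≥0)
    (p := fun s => |interpolationError t₁ t₂ x s| ≤ δ) (isClosed_le hc.abs continuous_const)
    h.1 s

theorem abs_sub_le_of_mem_polygonTube_left {t₁ t₂ : ℝ≥0} (h12 : t₁ < t₂) {m₁ m₂ δ : ℝ}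
    {x : ℝ≥0 → ℝ} (hx : Continuous x) (h : x ∈ polygonTube t₁ t₂ m₁ m₂ δ) {s : ℝ≥0}
    (hs : s ≤ t₁) : |x s - s / t₁ * m₁| ≤ 3 * δ := by
  have h1 := abs_interpolationError_le_of_mem hx h s
  have h2 := h.2.1
  have hδ : 0 ≤ δ := (abs_nonneg _).trans h1
  simp only [interpolationError, min_eq_left hs, min_eq_left (hs.trans h12.le), tsub_self,
    zero_div, NNReal.coe_zero, zero_mul, sub_zero, NNReal.coe_div] at h1
  have c0 : (0 : ℝ) ≤ s / t₁ := by positivity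
  have c1 : (s / t₁ : ℝ) ≤ 1 := div_le_one_of_le₀ (by exact_mod_cast hs) (by positivity)
  rw [abs_le] at h1 ⊢
  constructor <;> nlinarith [h2.1, h2.2]

/-- One δ each for the interpolation error, the first node and the increment. -/
theorem abs_sub_le_of_mem_polygonTube_right {t₁ t₂ : ℝ≥0} (h1 : 0 < t₁) (h12 : t₁ < t₂)
    {m₁ m₂ δ : ℝ} {x : ℝ≥0 → ℝ} (hx : Continuous x) (h : x ∈ polygonTube t₁ t₂ m₁ m₂ δ)
    {s : ℝ≥0} (hs : t₁ ≤ s) (hs' : s ≤ t₂) :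
    |x s - (m₁ + (s - t₁) / (t₂ - t₁) * m₂)| ≤ 3 * δ := by
  have h0 := abs_interpolationError_le_of_mem hx h s
  have hδ : 0 ≤ δ := (abs_nonneg _).trans h0
  simp only [interpolationError, min_eq_right hs, min_eq_left hs', div_self h1.ne',
    NNReal.coe_one, one_mul, NNReal.coe_div, NNReal.coe_sub hs, NNReal.coe_sub h12.le] at h0
  have hd : (0 : ℝ) < t₂ - t₁ := sub_pos.2 (by exact_mod_cast h12)
  have hs1 : (t₁ : ℝ) ≤ s := by exact_mod_cast hs
  have hs2 : (s : ℝ) ≤ t₂ := by exact_mod_cast hs'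
  have c0 : (0 : ℝ) ≤ (s - t₁) / (t₂ - t₁) := div_nonneg (by linarith) hd.le
  have c1 : ((s - t₁) / (t₂ - t₁) : ℝ) ≤ 1 := div_le_one_of_le₀ (by linarith) hd.le
  have h2 := h.2.1
  have h3 := h.2.2
  rw [abs_le] at h0 ⊢
  constructor <;> nlinarith [h2.1, h2.2, h3.1, h3.2]

/-- A Brownian motion stays close to `0` with large probability during a short time. -/
theorem ProbabilityTheory.IsBrownianReal.exists_half_le_measure {Ω : Type*}
    [MeasurableSpace Ω] {P : Measure Ω} {B : ℝ≥0 → Ω → ℝ} (hB : IsBrownianReal B P)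
    {ε : ℝ} (hε : 0 < ε) : ∃ t₀ > 0, 1 / 2 ≤ P {ω | ∀ s ≤ t₀, |B s ω| ≤ ε} := by
  have := hB.isGaussianProcess.isProbabilityMeasure
  set E : ℕ → Set Ω := fun n => {ω | ∀ s ≤ (1 / (n + 1) : ℝ≥0), |B s ω| ≤ ε} with hE
  have hmono : Monotone E := by
    intro i j hij ω hω s hs
    refine hω s (hs.trans ?_)
    gcongr
  have hone : P (⋃ n, E n) = 1 := by
    have : ∀ᵐ ω ∂P, ω ∈ ⋃ n, E n := by
      filter_upwards [hB.tendsto_nhds_zero] with ω hω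
      have hev : ∀ᶠ s in 𝓝 (0 : ℝ≥0), |B s ω| < ε := by
        have := hω.eventually (Metric.ball_mem_nhds 0 hε)
        simpa using this
      obtain ⟨δ, hδ, hδs⟩ := Metric.eventually_nhds_iff.1 hev
      obtain ⟨n, hn⟩ := exists_nat_one_div_lt hδ
      refine Set.mem_iUnion.2 ⟨n, fun s hs => (hδs ?_).le⟩
      rw [NNReal.dist_eq, NNReal.coe_zero, sub_zero, NNReal.abs_eq]
      refine lt_of_le_of_lt ?_ hn
      have : (s : ℝ) ≤ ((1 / (n + 1) : ℝ≥0) : ℝ) := by exact_mod_cast hs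
      simpa using this
    exact (measure_congr (eventuallyEq_univ.2 this)).trans measure_univ
  have hlim := tendsto_measure_iUnion_atTop (μ := P) hmono
  rw [hone] at hlim
  obtain ⟨n, hn⟩ := (hlim.eventually (lt_mem_nhds
    (show (1 / 2 : ℝ≥0∞) < 1 by simp))).exists
  exact ⟨1 / (n + 1), by positivity, hn.le⟩

/-- The interpolation error, the value at t₁ and the increment to t₂ give three independent
conditions. The first has probability at least 1/2, uniformly in the nodes, once t₂ ≤ T. -/
theorem ProbabilityTheory.IsBrownianReal.le_measure_polygonTube {Ω : Type*}
    [MeasurableSpace Ω] {P : Measure Ω} {B : ℝ≥0 → Ω → ℝ} (hB : IsBrownianReal B P)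
    {δ : ℝ} (hδ : 0 < δ) : ∃ T > 0, ∀ t₁ t₂ : ℝ≥0, 0 < t₁ → t₁ < t₂ → t₂ ≤ T → ∀ m₁ m₂ : ℝ,
      ENNReal.ofReal (1 / 2 * (Real.exp (-(|m₁| + δ) ^ 2 / (2 * t₁)) *
        Real.exp (-(|m₂| + δ) ^ 2 / (2 * (t₂ - t₁))))) ≤
      P ((fun ω t => B t ω) ⁻¹' polygonTube t₁ t₂ m₁ m₂ δ) := by
  obtain ⟨t₀, ht₀, hP⟩ := hB.exists_half_le_measure (ε := δ / 4) (by positivity)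
  -- Below t₀ the error is at most 4 · δ/4; the other bound is the variance condition of
  -- `exp_le_gaussianReal_Icc`.
  refine ⟨min t₀ (Real.toNNReal (4 * δ ^ 2 / (2 * Real.pi))),
    lt_min ht₀ (Real.toNNReal_pos.2 (by positivity)), ?_⟩
  intro t₁ t₂ h1 h12 h2 m₁ m₂
  have hsmall : ∀ v : ℝ≥0, v ≤ t₂ → 2 * Real.pi * v ≤ 4 * δ ^ 2 := by
    intro v hv
    have hv' := NNReal.coe_le_coe.2 (hv.trans (h2.trans (min_le_right _ _)))
    rw [Real.coe_toNNReal _ (by positivity), le_div_iff₀ (by positivity)] at hv'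
    linarith
  have hi1 := (hB.indepFun_interpolationError h1 h12).measure_inter_preimage_eq_mul
    {x : ℝ≥0 → ℝ | ∀ n, |x (TopologicalSpace.denseSeq ℝ≥0 n)| ≤ δ}
    {y : Fin 2 → ℝ | y 0 ∈ Set.Icc (m₁ - δ) (m₁ + δ) ∧ y 1 - y 0 ∈ Set.Icc (m₂ - δ) (m₂ + δ)}
    (by
      rw [Set.ofPred_forall]
      exact MeasurableSet.iInter fun n =>
        measurableSet_le (continuous_abs.measurable.comp (measurable_pi_apply _))
          measurable_const)
    (by
      have e1 : MeasurableSet {y : Fin 2 → ℝ | y 0 ∈ Set.Icc (m₁ - δ) (m₁ + δ)} :=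
        (measurable_pi_apply 0) measurableSet_Icc
      have e2 : MeasurableSet {y : Fin 2 → ℝ | y 1 - y 0 ∈ Set.Icc (m₂ - δ) (m₂ + δ)} :=
        ((measurable_pi_apply 1).sub (measurable_pi_apply 0)) measurableSet_Icc
      exact e1.inter e2)
  have hi2 := (hB.hasIndepIncrements.indepFun_eval_sub (zero_le (a := t₁)) h12.le
    hB.eval_zero_ae_eq_zero).measure_inter_preimage_eq_mul
    (Set.Icc (m₁ - δ) (m₁ + δ)) (Set.Icc (m₂ - δ) (m₂ + δ)) measurableSet_Icc measurableSet_Icc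
  have hl1 : P (B t₁ ⁻¹' Set.Icc (m₁ - δ) (m₁ + δ)) =
      gaussianReal 0 t₁ (Set.Icc (m₁ - δ) (m₁ + δ)) :=
    (hB.hasLaw_eval t₁).measure_eq (p := fun x => x ∈ Set.Icc (m₁ - δ) (m₁ + δ))
      measurableSet_Icc
  have hl2 : P ((B t₂ - B t₁) ⁻¹' Set.Icc (m₂ - δ) (m₂ + δ)) =
      gaussianReal 0 (t₂ - t₁) (Set.Icc (m₂ - δ) (m₂ + δ)) := by
    have hv : nndist t₂.1 t₁.1 = t₂ - t₁ := by
      ext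
      rw [coe_nndist, Real.dist_eq, NNReal.coe_sub h12.le]
      exact abs_of_nonneg (sub_nonneg.2 (NNReal.coe_le_coe.2 h12.le))
    rw [← hv]
    exact (hB.hasLaw_sub t₂ t₁).measure_eq (p := fun x => x ∈ Set.Icc (m₂ - δ) (m₂ + δ))
      measurableSet_Icc
  have g1 := exp_le_gaussianReal_Icc h1 hδ (hsmall t₁ h12.le) m₁
  have g2 := exp_le_gaussianReal_Icc (tsub_pos_of_lt h12) hδ (hsmall (t₂ - t₁) tsub_le_self) m₂
  rw [NNReal.coe_sub h12.le] at g2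
  calc ENNReal.ofReal (1 / 2 * (Real.exp (-(|m₁| + δ) ^ 2 / (2 * t₁)) *
        Real.exp (-(|m₂| + δ) ^ 2 / (2 * (t₂ - t₁)))))
      = 1 / 2 * (ENNReal.ofReal (Real.exp (-(|m₁| + δ) ^ 2 / (2 * t₁))) *
        ENNReal.ofReal (Real.exp (-(|m₂| + δ) ^ 2 / (2 * (t₂ - t₁))))) := by
        rw [ENNReal.ofReal_mul (by norm_num), ENNReal.ofReal_mul (Real.exp_pos _).le]
        congr 1
        rw [ENNReal.ofReal_div_of_pos (by norm_num)]
        simp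
    _ ≤ P ((fun ω s => interpolationError t₁ t₂ (fun t => B t ω) s) ⁻¹'
          {x : ℝ≥0 → ℝ | ∀ n, |x (TopologicalSpace.denseSeq ℝ≥0 n)| ≤ δ}) *
        (P (B t₁ ⁻¹' Set.Icc (m₁ - δ) (m₁ + δ)) *
          P ((B t₂ - B t₁) ⁻¹' Set.Icc (m₂ - δ) (m₂ + δ))) := by
        rw [hl1, hl2]
        gcongr
        refine hP.trans (measure_mono fun ω hω n => ?_)
        have := abs_interpolationError_le h12.le (x := fun t => B t ω) (ε := δ / 4)
          (fun s hs => hω s (hs.trans (h2.trans (min_le_left _ _))))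
          (TopologicalSpace.denseSeq ℝ≥0 n)
        linarith
    _ = _ := by
        rw [← hi2]
        exact hi1.symm

/-! ### The lower bound for exit probabilities. -/

/-- The probability of leaving a simply connected domain before time `t` is at least of order
`exp (-κ / t)` for any `κ > d(V)² / 2`. -/
theorem IsPlanarBrownian.le_measure_exitTime {Ω : Type*} [MeasurableSpace Ω] {P : Measure Ω}
    {Z : ℝ≥0 → Ω → ℂ} (hZ : IsPlanarBrownian Z P) {V : Set ℂ} (hVo : IsOpen V)
    (hV : IsSimplyConnected V) (hVne : V ≠ Set.univ) (hV0 : (0 : ℂ) ∈ V) {κ : ℝ}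
    (hκ : boundaryDist V ^ 2 < 2 * κ) :
    ∀ᶠ t : ℝ in 𝓝[>] 0, ENNReal.ofReal (1 / 4 * Real.exp (-κ / t)) ≤
      P {ω | exitTime Z V ω < ENNReal.ofReal t} := by
  obtain ⟨z₀, hz₀, hne, hnorm⟩ := exists_frontier_norm_eq hVo hV0 hVne
  have hball := ball_subset_of_isOpen hVo hV0
  rw [← hnorm] at hball hκ
  have hn : 0 < ‖z₀‖ := norm_pos_iff.2 hne
  have hκ0 : 0 < κ := by nlinarith
  -- the first node is reached at time `α t`
  obtain ⟨α, hα0, hα1, hα⟩ : ∃ α : ℝ, 0 < α ∧ α < 1 ∧ ‖z₀‖ ^ 2 < 2 * κ * α := by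
    obtain ⟨q, hq1, hq2⟩ := exists_between ((div_lt_one (by positivity)).2 hκ)
    refine ⟨q, lt_trans (by positivity) hq1, hq2, ?_⟩
    rw [div_lt_iff₀ (by positivity)] at hq1
    linarith
  -- The turn takes time γt; half of the remaining time is used, so that it ends strictly before t.
  set γ : ℝ := (1 - α) / 2 with hγ
  have hγ0 : 0 < γ := by rw [hγ]; linarith
  set m₁ : ℝ → ℂ := fun r => z₀ * ⟨1 + r, -r⟩ with hm₁
  set m₂ : ℝ → ℂ := fun r => z₀ * ⟨-2 * r, 6 * r⟩ with hm₂
  -- Each coordinate deviates by at most 3d, so the path by at most 6d = ‖z₀‖ · r/4, the tolerance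
  -- of `exists_notMem_of_near_polygon`.
  set d : ℝ → ℝ := fun r => ‖z₀‖ * (r / 4) / 6 with hd
  set energy : ℝ → ℝ := fun r =>
    ((|(m₁ r).re| + d r) ^ 2 + (|(m₁ r).im| + d r) ^ 2) / (2 * α) +
    ((|(m₂ r).re| + d r) ^ 2 + (|(m₂ r).im| + d r) ^ 2) / (2 * γ) with henergy
  obtain ⟨r, hr0, hr1, hr⟩ : ∃ r : ℝ, 0 < r ∧ r ≤ 1 / 26 ∧ energy r < κ := by
    have hc : Continuous energy := by
      simp only [henergy, hm₁, hm₂, hd, Complex.mul_re, Complex.mul_im]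
      fun_prop
    -- At r = 0 the turn and the tube width cost nothing and only the straight run to z₀ remains;
    -- continuity then provides a small positive r.
    have h0 : energy 0 < κ := by
      have : energy 0 = ‖z₀‖ ^ 2 / (2 * α) := by
        simp [henergy, hm₁, hm₂, hd, Complex.sq_norm, Complex.normSq_apply]
        ring
      rw [this, div_lt_iff₀ (by positivity)]
      linarith
    have h1 : ∀ᶠ r in 𝓝[>] (0 : ℝ), energy r < κ :=
      ((hc.tendsto 0).eventually (gt_mem_nhds h0)).filter_mono nhdsWithin_le_nhds
    have h2 : ∀ᶠ r in 𝓝[>] (0 : ℝ), r ≤ 1 / 26 :=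
      (eventually_le_nhds (by norm_num)).filter_mono nhdsWithin_le_nhds
    obtain ⟨r, ⟨h1, h2⟩, h3⟩ := ((h1.and h2).and self_mem_nhdsWithin).exists
    exact ⟨r, h3, h2, h1⟩
  have hd0 : 0 < d r := by positivity
  obtain ⟨T, hT, hreT⟩ := hZ.re.le_measure_polygonTube hd0
  obtain ⟨T', hT', himT⟩ := hZ.im.le_measure_polygonTube hd0
  have hTT : (0 : ℝ) < min T T' := by positivity
  filter_upwards [self_mem_nhdsWithin, nhdsWithin_le_nhds (eventually_le_nhds hTT)] with t ht htT
  have ht : 0 < t := ht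
  obtain ⟨t₁, ht₁⟩ : ∃ t₁ : ℝ≥0, (t₁ : ℝ) = α * t := ⟨⟨α * t, by positivity⟩, rfl⟩
  obtain ⟨t₂, ht₂⟩ : ∃ t₂ : ℝ≥0, (t₂ : ℝ) = α * t + γ * t :=
    ⟨⟨α * t + γ * t, by positivity⟩, rfl⟩
  have h1 : 0 < t₁ := by
    rw [← NNReal.coe_pos, ht₁]
    positivity
  have h12 : t₁ < t₂ := by
    rw [← NNReal.coe_lt_coe, ht₁, ht₂]
    nlinarith [mul_pos hγ0 ht]
  have h2t : (t₂ : ℝ) < t := by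
    rw [ht₂, hγ]
    nlinarith
  have h2T : (t₂ : ℝ) ≤ min T T' := h2t.le.trans htT
  have hdiff : (t₂ - t₁ : ℝ) = γ * t := by rw [ht₁, ht₂]; ring
  have hPre := hreT t₁ t₂ h1 h12 (by exact_mod_cast h2T.trans (min_le_left _ _))
    (m₁ r).re (m₂ r).re
  have hPim := himT t₁ t₂ h1 h12 (by exact_mod_cast h2T.trans (min_le_right _ _))
    (m₁ r).im (m₂ r).im
  rw [hdiff, ht₁] at hPre hPim
  have hindep := hZ.indep.measure_inter_preimage_eq_mul _ _
    (measurableSet_polygonTube t₁ t₂ (m₁ r).re (m₂ r).re (d r))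
    (measurableSet_polygonTube t₁ t₂ (m₁ r).im (m₂ r).im (d r))
  calc ENNReal.ofReal (1 / 4 * Real.exp (-κ / t))
      ≤ _ := ENNReal.ofReal_le_ofReal ?_
    _ = _ := ENNReal.ofReal_mul (by positivity)
    _ ≤ _ := mul_le_mul' hPre hPim
    _ = _ := hindep.symm
    _ ≤ _ := measure_mono_ae ?_
  · have e : Real.exp (-κ / t) ≤ Real.exp (-energy r / t) := by
      gcongr
    refine (mul_le_mul_of_nonneg_left e (by norm_num)).trans (le_of_eq ?_)
    rw [show ∀ a b c d : ℝ, 1 / 2 * (a * b) * (1 / 2 * (c * d)) = 1 / 4 * ((a * b) * (c * d)) by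
      intros; ring, ← Real.exp_add, ← Real.exp_add, ← Real.exp_add]
    congr 2
    simp only [henergy]
    field_simp
    ring
  · filter_upwards [hZ.re.cont, hZ.im.cont, hZ.re.eval_zero_ae_eq_zero,
      hZ.im.eval_zero_ae_eq_zero] with ω hcre hcim hre0 him0
    rintro ⟨htre, htim⟩
    have hbound : ∀ w : ℂ, |w.re| ≤ 3 * d r → |w.im| ≤ 3 * d r → ‖w‖ ≤ ‖z₀‖ * (r / 4) := by
      intro w hw1 hw2
      have := Complex.norm_le_abs_re_add_abs_im w
      have : 6 * d r = ‖z₀‖ * (r / 4) := by simp only [hd]; ring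
      linarith
    have hcZ : Continuous fun s => Z s ω := by
      have : (fun s => Z s ω) = fun s => ((Z s ω).re : ℂ) + (Z s ω).im * Complex.I := by
        funext s
        exact (Complex.re_add_im _).symm
      rw [this]
      fun_prop
    have hZ0 : Z 0 ω = 0 := Complex.ext hre0 him0
    obtain ⟨s, hs, hsV⟩ := exists_notMem_of_near_polygon hVo hV hz₀ hball hne hcZ hZ0 h1 h12
      hr0 hr1
      (fun s hs => by
        have e1 := abs_sub_le_of_mem_polygonTube_left h12 hcre htre hs
        have e2 := abs_sub_le_of_mem_polygonTube_left h12 hcim htim hs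
        refine hbound _ ?_ ?_
        · rwa [Complex.sub_re, Complex.re_ofReal_mul]
        · rwa [Complex.sub_im, Complex.im_ofReal_mul])
      (fun s hs hs' => by
        have e1 := abs_sub_le_of_mem_polygonTube_right h1 h12 hcre htre hs hs'
        have e2 := abs_sub_le_of_mem_polygonTube_right h1 h12 hcim htim hs hs'
        refine hbound _ ?_ ?_
        · rwa [Complex.sub_re, Complex.add_re, Complex.re_ofReal_mul]
        · rwa [Complex.sub_im, Complex.add_im, Complex.im_ofReal_mul])
    have hs0 : 0 < s := by
      rcases eq_or_lt_of_le (zero_le (a := s)) with h | h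
      · rw [← h, hZ0] at hsV
        exact absurd hV0 hsV
      · exact h
    refine lt_of_le_of_lt (sInf_le ⟨s, ⟨hs0, hsV⟩, rfl⟩) ?_
    change (s : ℝ≥0∞) < _
    rw [← ENNReal.ofReal_coe_nnreal, ENNReal.ofReal_lt_ofReal_iff ht]
    exact lt_of_le_of_lt (by exact_mod_cast hs) h2t

/-! ### Comparison of the two rates. -/

theorem theorem1 {Ω : Type*} [MeasurableSpace Ω] (P : Measure Ω) [IsProbabilityMeasure P]
    (Z : ℝ≥0 → Ω → ℂ) (hZ : IsPlanarBrownian Z P)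
    (U W : Set ℂ)
    (hUo : IsOpen U) (hUsc : IsSimplyConnected U) (hU : U ≠ Set.univ) (hU0 : (0 : ℂ) ∈ U)
    (hWo : IsOpen W) (hWsc : IsSimplyConnected W) (hW : W ≠ Set.univ) (hW0 : (0 : ℂ) ∈ W)
    (hd : boundaryDist U < 1 / Real.sqrt 2 * boundaryDist W) :
    (∀ᶠ t : ℝ in 𝓝[>] 0,
      P.real {ω | exitTime Z W ω < ENNReal.ofReal t} <
        P.real {ω | exitTime Z U ω < ENNReal.ofReal t}) ∧
    Tendsto (fun t : ℝ =>
      P.real {ω | exitTime Z U ω < ENNReal.ofReal t} /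
        P.real {ω | exitTime Z W ω < ENNReal.ofReal t}) (𝓝[>] 0) atTop := by
  have hU' : 0 ≤ boundaryDist U :=
    Real.sInf_nonneg (by rintro _ ⟨z, -, rfl⟩; exact norm_nonneg z)
  have hlower : ∀ V : Set ℂ, IsOpen V → IsSimplyConnected V → V ≠ Set.univ → (0 : ℂ) ∈ V →
      ∀ κ : ℝ, boundaryDist V ^ 2 < 2 * κ → ∀ᶠ t : ℝ in 𝓝[>] 0,
        1 / 4 * Real.exp (-κ / t) ≤ P.real {ω | exitTime Z V ω < ENNReal.ofReal t} := by
    intro V hVo hVsc hV hV0 κ hκ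
    filter_upwards [hZ.le_measure_exitTime hVo hVsc hV hV0 hκ] with t ht
    exact (ENNReal.ofReal_le_iff_le_toReal (measure_ne_top _ _)).1 ht
  obtain ⟨c, hUc, hcW⟩ := exists_between hd
  have hc0 : 0 ≤ c := hU'.trans hUc.le
  have hcW' : 2 * c ^ 2 < boundaryDist W ^ 2 := by
    have h : √2 * c < boundaryDist W := by
      rw [one_div, inv_mul_eq_div, lt_div_iff₀ (by positivity)] at hcW
      linarith
    have h2 := pow_lt_pow_left₀ h (by positivity) two_ne_zero
    rwa [mul_pow, Real.sq_sqrt (by norm_num)] at h2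
  -- With d(U)² < q < c², the rate q/2 bounds the exit from U below and c²/2 bounds the exit from W
  -- above.
  obtain ⟨q, hq1, hq2⟩ := exists_between (pow_lt_pow_left₀ hUc hU' two_ne_zero)
  -- The lower bound applied to W itself keeps the denominator nonzero, since real division by 0
  -- would give 0.
  have hpos : ∀ᶠ t : ℝ in 𝓝[>] 0, 0 < P.real {ω | exitTime Z W ω < ENNReal.ofReal t} := by
    filter_upwards [hlower W hWo hWsc hW hW0 (boundaryDist W ^ 2) (by
      have := sq_nonneg c
      linarith)] with t ht
    exact lt_of_lt_of_le (by positivity) ht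
  -- The constant 1/32 is the 1/4 of the lower bound over the 8 of the upper bound.
  have hratio : ∀ᶠ t : ℝ in 𝓝[>] 0, 1 / 32 * Real.exp ((c ^ 2 - q) / 2 * t⁻¹) ≤
      P.real {ω | exitTime Z U ω < ENNReal.ofReal t} /
        P.real {ω | exitTime Z W ω < ENNReal.ofReal t} := by
    filter_upwards [hpos, hlower U hUo hUsc hU hU0 (q / 2) (by linarith), self_mem_nhdsWithin]
      with t hWt hUt ht
    have ht : 0 < t := ht
    have hWle : P.real {ω | exitTime Z W ω < ENNReal.ofReal t} ≤
        8 * Real.exp (-c ^ 2 / (2 * t)) := by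
      refine ENNReal.toReal_le_of_le_ofReal (by positivity) ?_
      rw [ENNReal.ofReal_mul (by norm_num)]
      simpa using hZ.measure_exitTime_le hWo hW0 hc0 hcW' ht
    rw [le_div_iff₀ hWt]
    calc _ ≤ 1 / 32 * Real.exp ((c ^ 2 - q) / 2 * t⁻¹) * (8 * Real.exp (-c ^ 2 / (2 * t))) := by
          gcongr
      _ = 1 / 4 * (Real.exp ((c ^ 2 - q) / 2 * t⁻¹) * Real.exp (-c ^ 2 / (2 * t))) := by ring
      _ = 1 / 4 * Real.exp (-(q / 2) / t) := by
          rw [← Real.exp_add]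
          congr 2
          field_simp
          ring
      _ ≤ _ := hUt
  have hlim : Tendsto (fun t : ℝ => P.real {ω | exitTime Z U ω < ENNReal.ofReal t} /
      P.real {ω | exitTime Z W ω < ENNReal.ofReal t}) (𝓝[>] 0) atTop := by
    refine tendsto_atTop_mono' _ hratio ?_
    refine Tendsto.const_mul_atTop (by norm_num) (Real.tendsto_exp_atTop.comp ?_)
    exact tendsto_inv_nhdsGT_zero.const_mul_atTop (by linarith)
  refine ⟨?_, hlim⟩
  filter_upwards [hpos, hlim.eventually_gt_atTop 1] with t hWt ht
  rwa [one_lt_div hWt] at ht
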